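/- For a closed set $M\subset\mathbb R^N$ let its reach be $$\tau=\sup\{r\ge 0:\ \text{every } p\in\mathbb R^N \text{ with } d(p,M)<r \text{ has exactly one nearest point on } M\}\in[0,\infty]$$ (with $d(p,\emptyset)=\infty$). Write $\|A\|_1=\max_j\sum_i|A_{ij}|$ and $|A|_2=\max_{x\ne0}|Ax|/|x|$ for matrices, $|\cdot|$ being the Euclidean norm. Let $k\ge 1$, let $f_1,\dots,f_k:\mathbb R^N\to\mathbb R$ be smooth, and let $M=Z(f_1,\dots,f_k)=\{x: f_1(x)=\dots=f_k(x)=0\}\subset U$ for a convex set $U\subset\mathbb R^N$. Let $g(x)\in\mathbb R^{k\times k}$ have the entries $g_{ij}=\langle\operatorname{grad}f_i,\operatorname{grad}f_j\rangle$. Let $C_1,\dots,C_4$ be real numbers with $C_2,C_3>0$ such that $$\|g\|_1\le C_1,\qquad |\operatorname{Hess}f_i|_2\le C_3,\qquad |\operatorname{grad}f_i|\le C_4\qquad(1\le i\le k)\quad\text{on } U,$$ and $$|\det g|\ge C_2\quad\text{on } M$$ (in particular, this holds if $|\det g|\ge C_2$ on all of $U$). Put $$C=N^{4+(N-1)/4}\,\frac{C_1^{(N-1)/2}}{C_2^{1/2}}.$$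 Then $$\tau\ \ge\ \min\left\{k^{-4-(k-1)/4}\,\frac{C_2^{1/2}}{C_1^{(k-1)/2}\,C_3},\quad \frac12\cdot\frac{1}{2kC_3C\,(C_4Ck+1)}\right\}.$$ The same inequality holds with the constant $C$ replaced by $k^{4+(k-1)/4}\,C_1^{(k-1)/2}/C_2^{1/2}$. -/

import Mathlib

open scoped ENNReal NNReal ContDiff

noncomputable section

/-- The common zero set `Z(f₁, …, f_k)`. -/
def zeroSet {N k : ℕ} (f : Fin k → EuclideanSpace ℝ (Fin N) → ℝ) :
    Set (EuclideanSpace ℝ (Fin N)) :=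
  {x | ∀ i, f i x = 0}

/-- The set `π_M(p)` of points of `M` nearest to `p`. -/
def nearestPoints {N : ℕ} (M : Set (EuclideanSpace ℝ (Fin N)))
    (p : EuclideanSpace ℝ (Fin N)) : Set (EuclideanSpace ℝ (Fin N)) :=
  {x | x ∈ M ∧ edist p x = Metric.infEDist p M}

/-- Federer's reach: the supremum of the radii `r ≥ 0` such that every point at distance less
than `r` from `M` has exactly one nearest point on `M`. It may be infinite (for example for an
affine subspace), so it is an extended nonnegative real. -/
def reach {N : ℕ} (M : Set (EuclideanSpace ℝ (Fin N))) : ℝ≥0∞ :=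
  ⨆ (r : ℝ≥0) (_ : ∀ p, Metric.infEDist p M < r → (nearestPoints M p).encard = 1), (r : ℝ≥0∞)

/-- The matrix `g` with entries `g_{ij} = ⟨grad f_i, grad f_j⟩`, at the point `x`. -/
def gramGrad {N k : ℕ} (f : Fin k → EuclideanSpace ℝ (Fin N) → ℝ)
    (x : EuclideanSpace ℝ (Fin N)) : Matrix (Fin k) (Fin k) ℝ :=
  Matrix.of fun i j => inner ℝ (gradient (f i) x) (gradient (f j) x)

/-- The matrix `1`-norm (the operator norm induced by the `ℓ¹` norm): the maximal absolute
column sum. -/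
def matrixOneNorm {k : ℕ} (A : Matrix (Fin k) (Fin k) ℝ) : ℝ :=
  ⨆ j, ∑ i, |A i j|

/-- The Hessian of `f` at `x`, as the linear operator `v ↦ ∇_v (grad f)`; its norm `‖·‖` is the
spectral norm of the Hessian matrix. -/
def hessian {N : ℕ} (f : EuclideanSpace ℝ (Fin N) → ℝ) (x : EuclideanSpace ℝ (Fin N)) :
    EuclideanSpace ℝ (Fin N) →L[ℝ] EuclideanSpace ℝ (Fin N) :=
  fderiv ℝ (gradient f) x

/-- The constant `n^{4+(n-1)/4} C₁^{(n-1)/2} / C₂^{1/2}`. -/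
def spanNormConst (n : ℕ) (C₁ C₂ : ℝ) : ℝ :=
  (n : ℝ) ^ (4 + ((n : ℝ) - 1) / 4) * (C₁ ^ (((n : ℝ) - 1) / 2) / C₂ ^ (1 / 2 : ℝ))

end

/-! Suppose `p` has two nearest points `a ≠ b` on `M`. Lagrange multipliers give `p - a = ∑ lᵢ grad
fᵢ(a)`. Equidistance gives `|b - a|² = 2⟨p - a, b - a⟩`, while Taylor's formula and `fᵢ(a) = fᵢ(b)`
give `|⟨grad fᵢ(a), b - a⟩| ≤ C₃|b - a|²/2`; hence `1 ≤ C₃ ∑ |lᵢ|`. Conversely `|p - a|² = lᵀ g l`,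
and the least eigenvalue of `g` is at least `C₂ / C₁^(k-1)`, so a small `|p - a|` forces small
multipliers. Together, `|p - a|² ≥ C₂ / (k C₃² C₁^(k-1))`, which already exceeds or equals the
square of the first entry of the minimum. -/

/-- An eigenvalue of a matrix is bounded by any bound on the absolute column sums. -/
theorem Matrix.eigenvalue_le_of_colSum_le {n : Type*} [Fintype n] {A : Matrix n n ℝ} {c μ : ℝ}
    (hc : ∀ j, ∑ i, |A i j| ≤ c) {v : n → ℝ} (hv : v ≠ 0) (h : A.mulVec v = μ • v) : μ ≤ c := by
  have hpos : 0 < ∑ j, |v j| := by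
    obtain ⟨j, hj⟩ := Function.ne_iff.mp hv
    exact Finset.sum_pos' (fun _ _ => abs_nonneg _) ⟨j, Finset.mem_univ _, abs_pos.mpr hj⟩
  refine le_of_mul_le_mul_right ?_ hpos
  calc μ * ∑ j, |v j| ≤ ∑ i, |μ * v i| := by
        rw [Finset.mul_sum]
        refine Finset.sum_le_sum fun i _ => ?_
        rw [abs_mul]
        exact mul_le_mul_of_nonneg_right (le_abs_self μ) (abs_nonneg _)
    _ = ∑ i, |∑ j, A i j * v j| := by
        refine Finset.sum_congr rfl fun i _ => ?_
        have := congrFun h i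
        simp only [Matrix.mulVec, dotProduct, Pi.smul_apply, smul_eq_mul] at this
        rw [this]
    _ ≤ ∑ i, ∑ j, |A i j| * |v j| := by
        refine Finset.sum_le_sum fun i _ => ?_
        simpa only [abs_mul] using Finset.abs_sum_le_sum_abs (fun j => A i j * v j) Finset.univ
    _ = ∑ j, (∑ i, |A i j|) * |v j| := by
        rw [Finset.sum_comm]
        simp only [Finset.sum_mul]
    _ ≤ ∑ j, c * |v j| :=
        Finset.sum_le_sum fun j _ => mul_le_mul_of_nonneg_right (hc j) (abs_nonneg _)
    _ = c * ∑ j, |v j| := by rw [Finset.mul_sum]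

/-- A lower bound for the quadratic form of a positive semidefinite matrix in terms of its
determinant and of a bound on its absolute column sums. -/
theorem Matrix.PosSemidef.det_mul_dotProduct_le {n : Type*} [Fintype n] [DecidableEq n]
    {A : Matrix n n ℝ} (hA : A.PosSemidef) {c : ℝ} (hc : ∀ j, ∑ i, |A i j| ≤ c) (x : n → ℝ) :
    A.det * (x ⬝ᵥ x) ≤ c ^ (Fintype.card n - 1) * (x ⬝ᵥ A.mulVec x) := by
  set b := hA.1.eigenvectorBasis
  set e := hA.1.eigenvalues
  have he0 : ∀ i, 0 ≤ e i := hA.eigenvalues_nonneg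
  have hec : ∀ i, e i ≤ c := fun i => by
    refine Matrix.eigenvalue_le_of_colSum_le hc (v := ⇑(b i)) ?_ (hA.1.mulVec_eigenvectorBasis i)
    intro h0
    exact b.orthonormal.ne_zero i (PiLp.ext fun j => congrFun h0 j)
  -- The determinant is the product of the eigenvalues; all factors but the `j`-th are at most `c`.
  have hdet : ∀ j, A.det ≤ c ^ (Fintype.card n - 1) * e j := fun j => by
    have h1 : A.det = ∏ i, e i := by simpa using hA.1.det_eq_prod_eigenvalues
    rw [h1, ← Finset.prod_erase_mul _ _ (Finset.mem_univ j)]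
    refine mul_le_mul_of_nonneg_right ?_ (he0 j)
    refine (Finset.prod_le_prod (fun i _ => he0 i) fun i _ => hec i).trans_eq ?_
    simp [Finset.card_erase_of_mem]
  set X : EuclideanSpace ℝ n := WithLp.toLp 2 x
  set Y : EuclideanSpace ℝ n := WithLp.toLp 2 (A.mulVec x)
  have hXX : x ⬝ᵥ x = ∑ i, inner ℝ X (b i) * inner ℝ (b i) X := by
    rw [b.sum_inner_mul_inner, EuclideanSpace.inner_toLp_toLp]
    simp
  have hXY : x ⬝ᵥ A.mulVec x = ∑ i, inner ℝ X (b i) * inner ℝ (b i) Y := by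
    rw [b.sum_inner_mul_inner, EuclideanSpace.inner_toLp_toLp]
    simp [dotProduct_comm]
  have hY : ∀ i, inner ℝ (b i) Y = e i * inner ℝ (b i) X := fun i => by
    have h1 : inner ℝ (b i) Y = A.mulVec x ⬝ᵥ ⇑(b i) := by
      simp [Y, EuclideanSpace.inner_eq_star_dotProduct]
    have h2 : inner ℝ (b i) X = x ⬝ᵥ ⇑(b i) := by
      simp [X, EuclideanSpace.inner_eq_star_dotProduct]
    have hT : A.transpose = A := by simpa using hA.1.eq
    rw [h1, h2, dotProduct_comm, Matrix.dotProduct_mulVec, ← Matrix.mulVec_transpose, hT,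
      hA.1.mulVec_eigenvectorBasis i, smul_dotProduct, dotProduct_comm, smul_eq_mul]
  rw [hXX, hXY, Finset.mul_sum, Finset.mul_sum]
  refine Finset.sum_le_sum fun i _ => ?_
  rw [hY, real_inner_comm X (b i)]
  nlinarith [mul_le_mul_of_nonneg_right (hdet i) (mul_self_nonneg (inner ℝ X (b i)))]

/-- Lagrange multipliers for the distance: at a point nearest to `p` at which the gradients of the
constraints are linearly independent, `p - a` is a combination of these gradients. -/
theorem exists_sub_eq_sum_smul_gradient {ι E : Type*} [Fintype ι] [NormedAddCommGroup E]
    [InnerProductSpace ℝ E] [CompleteSpace E] {f : ι → E → ℝ} {a p : E}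
    (hf : ∀ i, ContDiffAt ℝ 1 (f i) a)
    (hli : LinearIndependent ℝ fun i => gradient (f i) a)
    (hmin : ∀ x, (∀ i, f i x = f i a) → ‖a - p‖ ≤ ‖x - p‖) :
    ∃ l : ι → ℝ, p - a = ∑ i, l i • gradient (f i) a := by
  have hext : IsLocalExtrOn (fun x => ‖x - p‖ ^ 2) {x | ∀ i, f i x = f i a} a :=
    Or.inl (Filter.eventually_inf_principal.mpr
      (Filter.Eventually.of_forall fun x hx => by
        have := hmin x hx
        dsimp only
        gcongr))
  have hφ : HasStrictFDerivAt (fun x => ‖x - p‖ ^ 2) (2 • innerSL ℝ (a - p)) a := by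
    simpa using! (hasStrictFDerivAt_norm_sq (a - p)).comp a ((hasStrictFDerivAt_id a).sub_const p)
  obtain ⟨L, L₀, hne, hL⟩ := hext.exists_multipliers_of_hasStrictFDerivAt
    (fun i => (hf i).hasStrictFDerivAt one_ne_zero) hφ
  have hvec : (∑ i, L i • gradient (f i) a) + (2 * L₀) • (a - p) = 0 := by
    refine ext_inner_right ℝ fun w => ?_
    have h := congrArg (fun T : E →L[ℝ] ℝ => T w) hL
    simp only [add_apply, sum_apply, smul_apply, zero_apply, innerSL_apply_apply,
      smul_eq_mul, nsmul_eq_mul, Nat.cast_ofNat] at h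
    rw [inner_add_left, sum_inner, inner_zero_left]
    simp only [inner_smul_left, ← toDual_gradient, InnerProductSpace.toDual_apply_apply] at h ⊢
    simp only [conj_trivial]
    linarith
  -- A vanishing `L₀` would leave a nontrivial relation among the independent gradients.
  have hL₀ : L₀ ≠ 0 := by
    rintro rfl
    have hsum : ∑ i, L i • gradient (f i) a = 0 := by simpa using hvec
    exact hne (Prod.ext (funext (Fintype.linearIndependent_iff.mp hli L hsum)) rfl)
  refine ⟨fun i => (2 * L₀)⁻¹ * L i, ?_⟩
  have h2 : (2 * L₀) ≠ 0 := mul_ne_zero two_ne_zero hL₀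
  have h3 : ∑ i, L i • gradient (f i) a = (2 * L₀) • (p - a) := by
    rw [eq_neg_of_add_eq_zero_left hvec, ← smul_neg, neg_sub]
  simp only [mul_smul]
  rw [← Finset.smul_sum, h3, inv_smul_smul₀ h2]

/-- Second-order Taylor estimate along a segment on which the derivative of the gradient is
bounded. -/
theorem abs_sub_sub_inner_gradient_le {E : Type*} [NormedAddCommGroup E]
    [InnerProductSpace ℝ E] [CompleteSpace E] {f : E → ℝ} (hf : ContDiff ℝ 2 f) {U : Set E}
    (hU : Convex ℝ U) {K : ℝ} (hK : ∀ x ∈ U, ‖fderiv ℝ (gradient f) x‖ ≤ K) {a b : E}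
    (ha : a ∈ U) (hb : b ∈ U) :
    |f b - f a - inner ℝ (gradient f a) (b - a)| ≤ K * ‖b - a‖ ^ 2 / 2 := by
  have hd : Differentiable ℝ f := hf.differentiable two_ne_zero
  have hgd : Differentiable ℝ (gradient f) := by
    have h1 : ContDiff ℝ 1 (fderiv ℝ f) := hf.fderiv_right (by norm_num)
    exact (InnerProductSpace.toDual ℝ E).symm.differentiable.comp (h1.differentiable one_ne_zero)
  have hline : ∀ t : ℝ, HasDerivAt (fun t : ℝ => a + t • (b - a)) (b - a) t := fun t => by
    simpa using ((hasDerivAt_id t).smul_const (b - a)).const_add a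
  set h : ℝ → ℝ := fun t => f (a + t • (b - a)) - f a - t * inner ℝ (gradient f a) (b - a)
  have hder : ∀ t, HasDerivAt h
      (inner ℝ (gradient f (a + t • (b - a)) - gradient f a) (b - a)) t := fun t => by
    have h1 := (hd (a + t • (b - a))).hasFDerivAt.comp_hasDerivAt t (hline t)
    rw [← toDual_gradient, InnerProductSpace.toDual_apply_apply] at h1
    rw [inner_sub_left]
    have h2 := (hasDerivAt_id t).mul_const (inner ℝ (gradient f a) (b - a) : ℝ)
    rw [one_mul] at h2
    exact (h1.sub_const (f a)).sub h2
  -- Comparison function for `h`: the gradient is `K`-Lipschitz on `U`, so `|h'(t)| ≤ K‖b - a‖² t`.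
  have hB : ∀ t : ℝ, HasDerivAt (fun t : ℝ => K * ‖b - a‖ ^ 2 / 2 * t ^ 2)
      (K * ‖b - a‖ ^ 2 * t) t := fun t => by
    refine ((hasDerivAt_pow 2 t).const_mul (K * ‖b - a‖ ^ 2 / 2)).congr_deriv ?_
    norm_num
    ring
  have hbound : ∀ t ∈ Set.Ico (0 : ℝ) 1,
      ‖(inner ℝ (gradient f (a + t • (b - a)) - gradient f a) (b - a) : ℝ)‖ ≤
        K * ‖b - a‖ ^ 2 * t := fun t ht => by
    have hmem : a + t • (b - a) ∈ U := hU.add_smul_sub_mem ha hb ⟨ht.1, ht.2.le⟩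
    have h1 := hU.norm_image_sub_le_of_norm_fderiv_le (fun x _ => hgd x) hK ha hmem
    rw [add_sub_cancel_left, norm_smul, Real.norm_of_nonneg ht.1] at h1
    refine (norm_inner_le_norm _ _).trans ?_
    nlinarith [mul_le_mul_of_nonneg_right h1 (norm_nonneg (b - a))]
  have key := image_norm_le_of_norm_deriv_right_le_deriv_boundary
    (f := h) (a := 0) (b := 1) (fun t _ => (hder t).continuousAt.continuousWithinAt)
    (fun t _ => (hder t).hasDerivWithinAt) (by simp [h]) hB hbound (Set.right_mem_Icc.mpr zero_le_one)
  simpa [h] using key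

/-- Two distinct points of a common level set, equidistant from `p`, force the multipliers of
`p - a` to be large. -/
theorem one_le_mul_sum_abs_multipliers {ι E : Type*} [Fintype ι] [NormedAddCommGroup E]
    [InnerProductSpace ℝ E] [CompleteSpace E] {f : ι → E → ℝ} (hf : ∀ i, ContDiff ℝ 2 (f i))
    {U : Set E} (hU : Convex ℝ U) {K : ℝ}
    (hK : ∀ i, ∀ x ∈ U, ‖fderiv ℝ (gradient (f i)) x‖ ≤ K) {a b p : E}
    (ha : a ∈ U) (hb : b ∈ U) (hab : a ≠ b) (hfab : ∀ i, f i b = f i a)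
    (hdist : ‖p - a‖ = ‖p - b‖) {l : ι → ℝ} (hl : p - a = ∑ i, l i • gradient (f i) a) :
    1 ≤ K * ∑ i, |l i| := by
  have hpos : 0 < ‖b - a‖ ^ 2 := pow_pos (norm_pos_iff.mpr (sub_ne_zero.mpr hab.symm)) 2
  have h1 : ‖b - a‖ ^ 2 = 2 * inner ℝ (p - a) (b - a) := by
    have h := norm_sub_sq_real (p - a) (b - a)
    rw [sub_sub_sub_cancel_right, ← hdist] at h
    linarith
  have h2 : inner ℝ (p - a) (b - a) ≤ ∑ i, |l i| * (K * ‖b - a‖ ^ 2 / 2) := by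
    rw [hl, sum_inner]
    refine Finset.sum_le_sum fun i _ => ?_
    rw [inner_smul_left, conj_trivial]
    refine (le_abs_self _).trans ?_
    rw [abs_mul]
    refine mul_le_mul_of_nonneg_left ?_ (abs_nonneg _)
    have h := abs_sub_sub_inner_gradient_le (hf i) hU (hK i) ha hb
    rwa [hfab i, sub_self, zero_sub, abs_neg] at h
  rw [← Finset.sum_mul] at h2
  refine le_of_mul_le_mul_right ?_ hpos
  nlinarith

theorem colSum_le_matrixOneNorm {k : ℕ} (A : Matrix (Fin k) (Fin k) ℝ) (j : Fin k) :
    ∑ i, |A i j| ≤ matrixOneNorm A :=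
  le_ciSup (f := fun j => ∑ i, |A i j|) (Set.finite_range _).bddAbove j

theorem isClosed_zeroSet {N k : ℕ} {f : Fin k → EuclideanSpace ℝ (Fin N) → ℝ}
    (hf : ∀ i, Continuous (f i)) : IsClosed (zeroSet f) := by
  have : zeroSet f = ⋂ i, {x | f i x = 0} := by ext; simp [zeroSet]
  rw [this]
  exact isClosed_iInter fun i => isClosed_eq (hf i) continuous_const

theorem nearestPoints_nonempty {N : ℕ} {M : Set (EuclideanSpace ℝ (Fin N))} (hM : IsClosed M)
    (hne : M.Nonempty) (p : EuclideanSpace ℝ (Fin N)) : (nearestPoints M p).Nonempty := by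
  obtain ⟨y, hy, h⟩ := hM.exists_infDist_eq_dist hne p
  refine ⟨y, hy, ?_⟩
  rw [edist_dist, ← h, Metric.infDist, ENNReal.ofReal_toReal (Metric.infEDist_ne_top hne)]

/-- If `p` has two distinct nearest points on `Z(f)`, then `p` is far from `Z(f)`. -/
theorem le_mul_norm_sq_of_two_nearestPoints {N k : ℕ}
    {f : Fin k → EuclideanSpace ℝ (Fin N) → ℝ} (hf : ∀ i, ContDiff ℝ 2 (f i))
    {U : Set (EuclideanSpace ℝ (Fin N))} (hU : Convex ℝ U) (hMU : zeroSet f ⊆ U)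
    {C₁ C₂ C₃ : ℝ} (hC₂ : 0 < C₂) (hg : ∀ x ∈ U, matrixOneNorm (gramGrad f x) ≤ C₁)
    (hdet : ∀ x ∈ zeroSet f, C₂ ≤ |(gramGrad f x).det|)
    (hhess : ∀ i, ∀ x ∈ U, ‖hessian (f i) x‖ ≤ C₃)
    {p a b : EuclideanSpace ℝ (Fin N)} (ha : a ∈ nearestPoints (zeroSet f) p)
    (hb : b ∈ nearestPoints (zeroSet f) p) (hab : a ≠ b) :
    C₂ ≤ C₃ ^ 2 * k * C₁ ^ (k - 1) * ‖p - a‖ ^ 2 := by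
  set v : Fin k → EuclideanSpace ℝ (Fin N) := fun i => gradient (f i) a
  have hgram : gramGrad f a = Matrix.gram ℝ v := rfl
  have hpsd : (gramGrad f a).PosSemidef := hgram ▸ Matrix.posSemidef_gram ℝ v
  have hdet' : C₂ ≤ (gramGrad f a).det := by
    simpa only [abs_of_nonneg hpsd.det_nonneg] using hdet a ha.1
  have hli : LinearIndependent ℝ v :=
    Matrix.linearIndependent_of_det_gram_ne_zero (𝕜 := ℝ) (hgram ▸ (hC₂.trans_le hdet').ne')
  have hfa : ∀ x, (∀ i, f i x = f i a) ↔ x ∈ zeroSet f := fun x =>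
    forall_congr' fun i => by rw [ha.1 i]
  obtain ⟨l, hl⟩ := exists_sub_eq_sum_smul_gradient (p := p)
    (fun i => ((hf i).of_le (by norm_num)).contDiffAt) hli fun x hx => by
      have h := ha.2.trans_le (Metric.infEDist_le_edist_of_mem ((hfa x).mp hx))
      rwa [edist_comm, edist_comm p, edist_dist, edist_dist, ENNReal.ofReal_le_ofReal_iff dist_nonneg, dist_eq_norm, dist_eq_norm] at h
  have hdist : ‖p - a‖ = ‖p - b‖ := by
    have h := ha.2.trans hb.2.symm
    rwa [edist_dist, edist_dist, ENNReal.ofReal_eq_ofReal_iff dist_nonneg dist_nonneg,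
      dist_eq_norm, dist_eq_norm] at h
  have h1 := one_le_mul_sum_abs_multipliers hf hU hhess (hMU ha.1) (hMU hb.1) hab
    ((hfa b).mpr hb.1) hdist hl
  -- Cauchy–Schwarz passes from the `ℓ¹` to the `ℓ²` norm of the multipliers, at the cost of the
  -- factor `k`.
  have h2 : (∑ i, |l i|) ^ 2 ≤ k * ∑ i, l i ^ 2 := by
    simpa [sq_abs] using sq_sum_le_card_mul_sum_sq (s := Finset.univ) (f := fun i => |l i|)
  have h3 : C₂ * ∑ i, l i ^ 2 ≤ C₁ ^ (k - 1) * ‖p - a‖ ^ 2 := by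
    have h := hpsd.det_mul_dotProduct_le
      (fun j => (colSum_le_matrixOneNorm _ j).trans (hg a (hMU ha.1))) l
    have hq : l ⬝ᵥ (gramGrad f a).mulVec l = ‖p - a‖ ^ 2 := by
      have := Matrix.star_dotProduct_gram_mulVec (𝕜 := ℝ) v l l
      rw [hgram, hl, ← real_inner_self_eq_norm_sq, ← this, star_trivial]
    have hs : l ⬝ᵥ l = ∑ i, l i ^ 2 := by simp [dotProduct, sq]
    rw [hq, hs, Fintype.card_fin] at h
    exact (mul_le_mul_of_nonneg_right hdet' (Finset.sum_nonneg fun i _ => sq_nonneg _)).trans h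
  have h4 : 1 ≤ C₃ ^ 2 * (∑ i, |l i|) ^ 2 := by
    rw [← mul_pow]
    exact one_le_pow₀ h1
  calc C₂ = C₂ * 1 := (mul_one _).symm
    _ ≤ C₂ * (C₃ ^ 2 * (k * ∑ i, l i ^ 2)) := by gcongr; exact h4.trans (by gcongr)
    _ = C₃ ^ 2 * k * (C₂ * ∑ i, l i ^ 2) := by ring
    _ ≤ C₃ ^ 2 * k * (C₁ ^ (k - 1) * ‖p - a‖ ^ 2) := by gcongr
    _ = C₃ ^ 2 * k * C₁ ^ (k - 1) * ‖p - a‖ ^ 2 := by ring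

/-- After squaring, the powers of `C₁`, `C₂`, `C₃` cancel exactly. The power of `k` has room to
spare: exponent `-1/2` would suffice. -/
theorem sq_mul_lt_of_lt_rpow_bound {k : ℕ} (hk : 1 ≤ k) {C₁ C₂ C₃ d : ℝ} (hC₁ : 0 < C₁)
    (hC₂ : 0 < C₂) (hC₃ : 0 < C₃) (hd0 : 0 ≤ d)
    (hd : d < (k : ℝ) ^ (-4 - ((k : ℝ) - 1) / 4) *
      (C₂ ^ (1 / 2 : ℝ) / (C₁ ^ (((k : ℝ) - 1) / 2) * C₃))) :
    C₃ ^ 2 * k * C₁ ^ (k - 1) * d ^ 2 < C₂ := by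
  have hk1 : (1 : ℝ) ≤ k := by exact_mod_cast hk
  have hk0 : (0 : ℝ) < k := by linarith
  have hC₁sq : (C₁ ^ (((k : ℝ) - 1) / 2)) ^ 2 = C₁ ^ (k - 1) := by
    rw [← Real.rpow_natCast (_ ^ _), ← Real.rpow_mul hC₁.le, ← Real.rpow_natCast C₁,
      Nat.cast_sub hk]
    congr 1
    push_cast
    ring
  have hC₂sq : (C₂ ^ (1 / 2 : ℝ)) ^ 2 = C₂ := by
    rw [← Real.sqrt_eq_rpow, Real.sq_sqrt hC₂.le]
  have hksq : k * ((k : ℝ) ^ (-4 - ((k : ℝ) - 1) / 4)) ^ 2 ≤ 1 := by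
    calc k * ((k : ℝ) ^ (-4 - ((k : ℝ) - 1) / 4)) ^ 2
        ≤ k * ((k : ℝ) ^ (-1 / 2 : ℝ)) ^ 2 := by
          gcongr
          linarith
      _ = 1 := by
          rw [← Real.rpow_natCast (_ ^ _), ← Real.rpow_mul hk0.le]
          norm_num
          rw [Real.rpow_neg_one, mul_inv_cancel₀ hk0.ne']
  have hpow : 0 < C₁ ^ (k - 1) := pow_pos hC₁ _
  have hsq := pow_lt_pow_left₀ hd hd0 two_ne_zero
  rw [mul_pow, div_pow, mul_pow, hC₁sq, hC₂sq] at hsq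
  calc C₃ ^ 2 * k * C₁ ^ (k - 1) * d ^ 2
      < C₃ ^ 2 * k * C₁ ^ (k - 1) * (((k : ℝ) ^ (-4 - ((k : ℝ) - 1) / 4)) ^ 2 *
          (C₂ / (C₁ ^ (k - 1) * C₃ ^ 2))) := by gcongr
    _ = (k * ((k : ℝ) ^ (-4 - ((k : ℝ) - 1) / 4)) ^ 2) * C₂ := by field_simp
    _ ≤ 1 * C₂ := by gcongr
    _ = C₂ := one_mul _

/-- Positivity of `C₁` is what the real-power identities need. With `k ≥ 1`, a zero matrix has zero
determinant. -/
theorem pos_of_matrixOneNorm_le {k : ℕ} (hk : 1 ≤ k) {A : Matrix (Fin k) (Fin k) ℝ} {c : ℝ}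
    (hA : A.det ≠ 0) (hc : matrixOneNorm A ≤ c) : 0 < c := by
  have : Nonempty (Fin k) := ⟨⟨0, hk⟩⟩
  by_contra! h
  refine hA ?_
  have hzero : A = 0 := Matrix.ext fun i j => abs_eq_zero.mp (le_antisymm
    (((Finset.single_le_sum (f := fun i => |A i j|) (fun _ _ => abs_nonneg _)
      (Finset.mem_univ i)).trans (colSum_le_matrixOneNorm A j)).trans (hc.trans h)) (abs_nonneg _))
  rw [hzero, Matrix.det_zero]

theorem mainTheorem9 (N k : ℕ) (hk : 1 ≤ k)
    (f : Fin k → EuclideanSpace ℝ (Fin N) → ℝ) (hf : ∀ i, ContDiff ℝ ∞ (f i))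
    (U : Set (EuclideanSpace ℝ (Fin N))) (hU : Convex ℝ U) (hMU : zeroSet f ⊆ U)
    (C₁ C₂ C₃ C₄ : ℝ) (hC₂ : 0 < C₂) (hC₃ : 0 < C₃)
    (hg : ∀ x ∈ U, matrixOneNorm (gramGrad f x) ≤ C₁)
    (hdet : ∀ x ∈ zeroSet f, C₂ ≤ |(gramGrad f x).det|)
    (hhess : ∀ i, ∀ x ∈ U, ‖hessian (f i) x‖ ≤ C₃)
    (hgrad : ∀ i, ∀ x ∈ U, ‖gradient (f i) x‖ ≤ C₄)
    (C : ℝ) (hC : C = spanNormConst N C₁ C₂ ∨ C = spanNormConst k C₁ C₂) :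
    ENNReal.ofReal
      (min
        ((k : ℝ) ^ (-4 - ((k : ℝ) - 1) / 4) *
          (C₂ ^ (1 / 2 : ℝ) / (C₁ ^ (((k : ℝ) - 1) / 2) * C₃)))
        (1 / 2 * (1 / (2 * k * C₃ * C * (C₄ * C * k + 1)))))
      ≤ reach (zeroSet f) := by
  refine (ENNReal.ofReal_le_ofReal (min_le_left _ _)).trans ?_
  refine le_iSup₂_of_le (f := fun (r : ℝ≥0) _ => (r : ℝ≥0∞)) (Real.toNNReal _) ?_ le_rfl
  intro p hp
  -- For empty `M` the distance is `⊤`, never below a finite radius.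
  have hne : (zeroSet f).Nonempty := by
    by_contra h
    rw [Set.not_nonempty_iff_eq_empty] at h
    simp [h] at hp
  obtain ⟨a, ha⟩ := nearestPoints_nonempty (isClosed_zeroSet fun i => (hf i).continuous) hne p
  refine Set.encard_eq_one.mpr ⟨a, Set.eq_singleton_iff_unique_mem.mpr ⟨ha, fun b hb => ?_⟩⟩
  by_contra hba
  have hC₁ : 0 < C₁ := pos_of_matrixOneNorm_le hk
    (abs_pos.mp (hC₂.trans_le (hdet a ha.1))) (hg a (hMU ha.1))
  have hd : ‖p - a‖ < (k : ℝ) ^ (-4 - ((k : ℝ) - 1) / 4) *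
      (C₂ ^ (1 / 2 : ℝ) / (C₁ ^ (((k : ℝ) - 1) / 2) * C₃)) := by
    rw [← ha.2, edist_dist] at hp
    simpa only [dist_eq_norm] using
      (ENNReal.ofReal_lt_ofReal_iff_of_nonneg dist_nonneg).mp hp
  exact absurd (sq_mul_lt_of_lt_rpow_bound hk hC₁ hC₂ hC₃ (norm_nonneg _) hd)
    (le_mul_norm_sq_of_two_nearestPoints (fun i => contDiff_infty.mp (hf i) 2)
      hU hMU hC₂ hg hdet hhess ha hb (Ne.symm hba)).not_gt
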